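/- Let $S$ be a commutative semiring with involution. Let $\mathrm{Mat}(S)$ be the category whose objects are the free finite-dimensional $S$-modules $S^X$, for $X$ a finite set, and whose morphisms $S^X\to S^Y$ are the $S$-linear maps, written as $S$-valued matrices; its hom-sets are $S$-modules under entrywise operations. An $S$-bilinear compact closed symmetric monoidal structure $T=(\odot,J,{}^\circ,\bar\eta,\bar\epsilon)$ on $\mathrm{Mat}(S)$ is a symmetric monoidal structure $(\odot,J)$ on this category for which $(f,g)\mapsto f\odot g$ is $S$-bilinear on morphisms, together with, for each object $A$, a chosen dual $A^\circ$, a cup $\bar\eta_A:J\to A^\circ\odot A$ and a cap $\bar\epsilon_A:A\odot A^\circ\to J$ satisfying the two yanking (snake) equations. The standard such structure $(\otimes,S,{}^*,\eta,\epsilon)$ has $S^X\otimes S^Y=S^{X\times Y}$, unit $S=S^1$, the Kronecker product of matrices on morphisms, the evident associators, unitors and symmetry, duals $(S^X)^*\cong S^X$ with the dual basis $(|x^*\rangle)_{x\in X}$, and cups and caps $$\eta_{S^X}=\sum_{x\in X}|x^*\rangle\otimes|x\rangle,\qquad \epsilon_{S^X}=\sum_{x\in X}\langle x|\otimes\langle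 x^*|.$$ **Theorem.** There is exactly one $S$-bilinear compact closed symmetric monoidal structure on $\mathrm{Mat}(S)$ up to $S$-linear monoidal equivalence. That is, the standard structure is one, and for every such structure $T$ there is an equivalence of categories $F:\mathrm{Mat}(S)\to\mathrm{Mat}(S)$ which is $S$-linear on hom-sets, is a strong symmetric monoidal functor from $(\otimes,S)$ to $(\odot,J)$, and preserves cups and caps: there are isomorphisms $\theta_A:F(A^*)\to F(A)^\circ$, natural in $A$ (with respect to the action of the duals on morphisms), such that, up to the structure isomorphisms of $F$, $\theta$ carries $F(\eta_A)$ to $\bar\eta_{F(A)}$ and $F(\epsilon_A)$ to $\bar\epsilon_{F(A)}$. -/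

import Mathlib

open CategoryTheory MonoidalCategory

universe v u v₁ u₁ v₂ u₂ w

noncomputable section

/-! ### Categories linear over a commutative semiring -/

/-- An `S`-linear structure on a category, for a commutative semiring `S`: every hom-set is an
`S`-semimodule and composition is `S`-bilinear. (Mathlib's `CategoryTheory.Linear` requires hom-sets
to be additive groups, so it does not apply to semirings.) -/
class SemiringLinear (S : Type w) [CommSemiring S] (C : Type u) [Category.{v} C] where
  homAddCommMonoid : ∀ X Y : C, AddCommMonoid (X ⟶ Y)
  homModule : ∀ X Y : C, Module S (X ⟶ Y)
  add_comp : ∀ {X Y Z : C} (f f' : X ⟶ Y) (g : Y ⟶ Z), (f + f') ≫ g = f ≫ g + f' ≫ g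
  smul_comp : ∀ {X Y Z : C} (s : S) (f : X ⟶ Y) (g : Y ⟶ Z), (s • f) ≫ g = s • (f ≫ g)
  comp_add : ∀ {X Y Z : C} (f : X ⟶ Y) (g g' : Y ⟶ Z), f ≫ (g + g') = f ≫ g + f ≫ g'
  comp_smul : ∀ {X Y Z : C} (s : S) (f : X ⟶ Y) (g : Y ⟶ Z), f ≫ (s • g) = s • (f ≫ g)

/-- The addition of morphisms in an `S`-linear category. It is not a global instance, because `S`
cannot be recovered from the hom-set. -/
abbrev SemiringLinear.homAdd (S : Type w) [CommSemiring S] {C : Type u} [Category.{v} C]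
    [SemiringLinear S C] {X Y : C} (f g : X ⟶ Y) : X ⟶ Y :=
  letI := SemiringLinear.homAddCommMonoid S X Y
  f + g

/-- The scalar multiplication of morphisms in an `S`-linear category. -/
abbrev SemiringLinear.homSmul {S : Type w} [CommSemiring S] {C : Type u} [Category.{v} C]
    [SemiringLinear S C] {X Y : C} (s : S) (f : X ⟶ Y) : X ⟶ Y :=
  letI := SemiringLinear.homAddCommMonoid S X Y
  letI := SemiringLinear.homModule (S := S) X Y
  s • f

/-- A functor between `S`-linear categories is `S`-linear if it is `S`-linear on hom-sets. -/
structure IsSLinearFunctor (S : Type w) [CommSemiring S] {C : Type u₁} [Category.{v₁} C]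
    [SemiringLinear S C] {D : Type u₂} [Category.{v₂} D] [SemiringLinear S D] (F : C ⥤ D) :
    Prop where
  map_add : ∀ {X Y : C} (f g : X ⟶ Y),
    F.map (SemiringLinear.homAdd S f g) = SemiringLinear.homAdd S (F.map f) (F.map g)
  map_smul : ∀ {X Y : C} (s : S) (f : X ⟶ Y),
    F.map (SemiringLinear.homSmul s f) = SemiringLinear.homSmul s (F.map f)

/-! ### Bilinear compact closed symmetric monoidal structures -/

/-- An `S`-bilinear compact closed symmetric monoidal structure on an `S`-linear category `C`:
a symmetric monoidal structure whose tensor product is `S`-bilinear on morphisms, with a chosen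
dual `ᘁX` of every object `X`, a cup `𝟙_ C ⟶ ᘁX ⊗ X` and a cap `X ⊗ ᘁX ⟶ 𝟙_ C` satisfying the
two yanking equations (in Mathlib's terms, a `LeftRigidCategory`). -/
structure CompactClosedStructure (S : Type w) [CommSemiring S] (C : Type u) [Category.{v} C]
    [SemiringLinear S C] where
  [monoidal : MonoidalCategory C]
  [symmetric : SymmetricCategory C]
  [rigid : LeftRigidCategory C]
  add_tensor : ∀ {X Y Z W : C} (f f' : X ⟶ Y) (g : Z ⟶ W),
    SemiringLinear.homAdd S f f' ⊗ₘ g = SemiringLinear.homAdd S (f ⊗ₘ g) (f' ⊗ₘ g)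
  smul_tensor : ∀ {X Y Z W : C} (s : S) (f : X ⟶ Y) (g : Z ⟶ W),
    SemiringLinear.homSmul s f ⊗ₘ g = SemiringLinear.homSmul s (f ⊗ₘ g)
  tensor_add : ∀ {X Y Z W : C} (f : X ⟶ Y) (g g' : Z ⟶ W),
    f ⊗ₘ SemiringLinear.homAdd S g g' = SemiringLinear.homAdd S (f ⊗ₘ g) (f ⊗ₘ g')
  tensor_smul : ∀ {X Y Z W : C} (s : S) (f : X ⟶ Y) (g : Z ⟶ W),
    f ⊗ₘ SemiringLinear.homSmul s g = SemiringLinear.homSmul s (f ⊗ₘ g)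

namespace CompactClosedStructure

variable {S : Type w} [CommSemiring S] {C : Type u} [Category.{v} C] [SemiringLinear S C]

/-- The category `C`, equipped with the compact closed symmetric monoidal structure `T`. (A type
synonym of `C`, so that several structures on `C` can be considered at once.) -/
def Cat (_ : CompactClosedStructure S C) : Type u := C

instance (T : CompactClosedStructure S C) : Category.{v} T.Cat := inferInstanceAs (Category.{v} C)

instance (T : CompactClosedStructure S C) : SemiringLinear S T.Cat :=
  inferInstanceAs (SemiringLinear S C)

instance (T : CompactClosedStructure S C) : MonoidalCategory T.Cat := T.monoidal

instance (T : CompactClosedStructure S C) : SymmetricCategory T.Cat := T.symmetric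

instance (T : CompactClosedStructure S C) : LeftRigidCategory T.Cat := T.rigid

end CompactClosedStructure

/-- The compatibility of a strong monoidal functor `F` with chosen duals, cups and caps: a natural
isomorphism between `F` of the dual and the dual of `F`, under which the image of the cup
(respectively cap) of `X` is the cup (respectively cap) of `F X`, up to the structure isomorphisms
of `F`. -/
structure DualComparison {C : Type u₁} [Category.{v₁} C] [MonoidalCategory C]
    [LeftRigidCategory C] {D : Type u₂} [Category.{v₂} D] [MonoidalCategory D]
    [LeftRigidCategory D] (F : C ⥤ D) [F.Monoidal] where
  iso : ∀ X : C, F.obj (ᘁX : C) ≅ (ᘁ(F.obj X) : D)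
  naturality : ∀ {X Y : C} (f : X ⟶ Y),
    F.map (ᘁf) ≫ (iso X).hom = (iso Y).hom ≫ (ᘁ(F.map f))
  map_cup : ∀ X : C,
    F.map (η_ (ᘁX : C) X) ≫ Functor.OplaxMonoidal.δ F (ᘁX : C) X ≫ (iso X).hom ▷ F.obj X =
      Functor.OplaxMonoidal.η F ≫ η_ (ᘁ(F.obj X) : D) (F.obj X)
  map_cap : ∀ X : C,
    Functor.LaxMonoidal.μ F X (ᘁX : C) ≫ F.map (ε_ (ᘁX : C) X) =
      F.obj X ◁ (iso X).hom ≫ ε_ (ᘁ(F.obj X) : D) (F.obj X) ≫ Functor.LaxMonoidal.ε F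

/-- An `S`-linear monoidal equivalence from `(C, T)` to `(D, T')`: an `S`-linear equivalence of
categories which is a strong symmetric monoidal functor and preserves cups and caps. -/
structure LinearMonoidalEquivalence {S : Type w} [CommSemiring S]
    {C : Type u₁} [Category.{v₁} C] [SemiringLinear S C]
    {D : Type u₂} [Category.{v₂} D] [SemiringLinear S D]
    (T : CompactClosedStructure S C) (T' : CompactClosedStructure S D) where
  equiv : T.Cat ≌ T'.Cat
  linear : IsSLinearFunctor S equiv.functor
  [braided : equiv.functor.Braided]
  duals : DualComparison equiv.functor

/-! ### The category of matrices

`CategoryTheory.Mat S` has as objects the finite types `X`, standing for the free modules `S ^ X`,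
and as morphisms `X ⟶ Y` the matrices `Matrix X Y S`, standing for the `S`-linear maps
`S ^ X → S ^ Y`. Composition is matrix multiplication: `(f ≫ g) i k = ∑ j, f i j * g j k`. -/

namespace MatKronecker

variable (S : Type u) [CommSemiring S]

instance finiteObj (X : Mat S) : Finite X := ObjectProperty.FullSubcategory.property (P := Finite) X

/-- The `S`-linear structure of `Mat S`: entrywise addition and scalar multiplication. -/
instance semiringLinear : SemiringLinear S (Mat S) where
  homAddCommMonoid X Y := inferInstanceAs (AddCommMonoid (Matrix X Y S))
  homModule X Y := inferInstanceAs (Module S (Matrix X Y S))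
  add_comp {X Y Z} f f' g := by
    let : Fintype Y := Fintype.ofFinite Y
    exact Matrix.add_mul (show Matrix X Y S from f) f' (show Matrix Y Z S from g)
  smul_comp {X Y Z} s f g := by
    let : Fintype Y := Fintype.ofFinite Y
    exact Matrix.smul_mul s (show Matrix X Y S from f) (show Matrix Y Z S from g)
  comp_add {X Y Z} f g g' := by
    let : Fintype Y := Fintype.ofFinite Y
    exact Matrix.mul_add (show Matrix X Y S from f) (show Matrix Y Z S from g) g'
  comp_smul {X Y Z} s f g := by
    let : Fintype Y := Fintype.ofFinite Y
    exact Matrix.mul_smul (show Matrix X Y S from f) s (show Matrix Y Z S from g)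

variable {S}

theorem comp_apply {X Y Z : Mat S} [Fintype Y] (f : X ⟶ Y) (g : Y ⟶ Z) (i : X) (k : Z) :
    (f ≫ g) i k = ∑ j : Y, f i j * g j k := by
  rw [Mat.comp_apply]
  congr!

/-- The object `S ^ (X × Y) = S ^ X ⊗ S ^ Y`. -/
abbrev tensorObj (X Y : Mat S) : Mat S := FintypeCat.of (X × Y)

/-- The object `S = S ^ 1`. -/
abbrev unitObj : Mat S := FintypeCat.of PUnit.{u + 1}

/-- The Kronecker product of matrices. -/
def kron {X Y Z W : Mat S} (f : X ⟶ Y) (g : Z ⟶ W) : tensorObj X Z ⟶ tensorObj Y W :=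
  Matrix.kroneckerMap (fun a b => a * b) f g

open scoped Classical in
/-- The permutation matrix `|x⟩ ↦ |e x⟩` of a bijection `e` between the basis vectors. -/
def perm {X Y : Mat S} (e : X ≃ Y) : X ⟶ Y :=
  fun i j => if e i = j then 1 else 0

theorem kron_apply {X Y Z W : Mat S} (f : X ⟶ Y) (g : Z ⟶ W) (i : X × Z) (j : Y × W) :
    kron f g i j = f i.1 j.1 * g i.2 j.2 := rfl

theorem perm_comp {X Y Z : Mat S} (e : X ≃ Y) (g : Y ⟶ Z) (i : X) (k : Z) :
    (perm e ≫ g) i k = g (e i) k := by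
  classical
  let : Fintype Y := Fintype.ofFinite Y
  rw [comp_apply]
  simp [perm]

theorem comp_perm {X Y Z : Mat S} (f : X ⟶ Y) (e : Y ≃ Z) (i : X) (k : Z) :
    (f ≫ perm e) i k = f i (e.symm k) := by
  classical
  let : Fintype Y := Fintype.ofFinite Y
  rw [comp_apply]
  simp [perm, ← Equiv.eq_symm_apply]

theorem id_eq_perm (X : Mat S) : 𝟙 X = perm (Equiv.refl X) := by
  ext i j
  simp only [perm, Mat.id_apply, Equiv.refl_apply]
  congr!

theorem perm_comp_perm {X Y Z : Mat S} (e : X ≃ Y) (e' : Y ≃ Z) :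
    perm e ≫ perm e' = perm (S := S) (e.trans e') := by
  ext i j
  rw [perm_comp]
  rfl

/-- The isomorphism given by a bijection between the basis vectors. -/
def permIso {X Y : Mat S} (e : X ≃ Y) : X ≅ Y where
  hom := perm e
  inv := perm e.symm
  hom_inv_id := by rw [perm_comp_perm, Equiv.self_trans_symm, id_eq_perm]
  inv_hom_id := by rw [perm_comp_perm, Equiv.symm_trans_self, id_eq_perm]

theorem kron_comp {X₁ Y₁ Z₁ X₂ Y₂ Z₂ : Mat S} (f₁ : X₁ ⟶ Y₁) (f₂ : X₂ ⟶ Y₂) (g₁ : Y₁ ⟶ Z₁)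
    (g₂ : Y₂ ⟶ Z₂) : kron f₁ f₂ ≫ kron g₁ g₂ = kron (f₁ ≫ g₁) (f₂ ≫ g₂) := by
  let : Fintype Y₁ := Fintype.ofFinite Y₁
  let : Fintype Y₂ := Fintype.ofFinite Y₂
  ext i k
  rw [comp_apply (Y := tensorObj Y₁ Y₂), kron_apply, comp_apply, comp_apply,
    Finset.sum_mul_sum, Fintype.sum_prod_type]
  simp only [kron_apply]
  refine Finset.sum_congr rfl fun a _ => Finset.sum_congr rfl fun b _ => ?_
  ring

theorem kron_perm {X Y Z W : Mat S} (e : X ≃ Y) (e' : Z ≃ W) :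
    kron (perm e) (perm e') = perm (S := S) (X := tensorObj X Z) (Y := tensorObj Y W)
      (Equiv.prodCongr e e') := by
  ext ⟨i, i'⟩ ⟨j, j'⟩
  simp only [kron_apply, perm, Equiv.prodCongr_apply, Prod.map_apply, Prod.mk.injEq]
  split_ifs <;> simp_all

theorem comp_eq_perm {X Y Z : Mat S} {f : X ⟶ Y} {g : Y ⟶ Z} {e : X ≃ Y} {e' : Y ≃ Z}
    (hf : f = perm e) (hg : g = perm e') : f ≫ g = perm (e.trans e') := by
  rw [hf, hg, perm_comp_perm]

theorem kron_eq_perm {X Y Z W : Mat S} {f : X ⟶ Y} {g : Z ⟶ W} {e : X ≃ Y} {e' : Z ≃ W}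
    (hf : f = perm e) (hg : g = perm e') :
    kron f g = perm (S := S) (X := tensorObj X Z) (Y := tensorObj Y W) (Equiv.prodCongr e e') := by
  rw [hf, hg, kron_perm]

theorem eq_of_eq_perm {X Y : Mat S} {f g : X ⟶ Y} {e e' : X ≃ Y} (hf : f = perm e)
    (hg : g = perm e') (h : e = e') : f = g := by
  rw [hf, hg, h]

/-- The Kronecker product on `Mat S`, with unit `S ^ 1` and the evident structure isomorphisms. -/
instance monoidalStruct : MonoidalCategoryStruct (Mat S) where
  tensorObj := tensorObj
  tensorUnit := unitObj
  tensorHom := kron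
  whiskerLeft X _ _ f := kron (𝟙 X) f
  whiskerRight f Y := kron f (𝟙 Y)
  associator X Y Z := permIso (X := tensorObj (tensorObj X Y) Z) (Y := tensorObj X (tensorObj Y Z))
    (Equiv.prodAssoc X Y Z)
  leftUnitor X := permIso (X := tensorObj unitObj X) (Equiv.punitProd X)
  rightUnitor X := permIso (X := tensorObj X unitObj) (Equiv.prodPUnit X)

theorem kron_id (X Y : Mat S) : kron (𝟙 X) (𝟙 Y) = 𝟙 (tensorObj X Y) := by
  rw [id_eq_perm, id_eq_perm, id_eq_perm, kron_perm]
  rfl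

theorem associator_nat {X₁ X₂ X₃ Y₁ Y₂ Y₃ : Mat S} (f₁ : X₁ ⟶ Y₁) (f₂ : X₂ ⟶ Y₂) (f₃ : X₃ ⟶ Y₃) :
    kron (kron f₁ f₂) f₃ ≫ (α_ Y₁ Y₂ Y₃).hom = (α_ X₁ X₂ X₃).hom ≫ kron f₁ (kron f₂ f₃) := by
  ext i k
  refine (comp_perm _ _ _ _).trans (Eq.trans ?_ (perm_comp _ _ _ _).symm)
  exact mul_assoc _ _ _

theorem leftUnitor_nat {X Y : Mat S} (f : X ⟶ Y) :
    kron (𝟙 unitObj) f ≫ (λ_ Y).hom = (λ_ X).hom ≫ f := by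
  ext i k
  refine (comp_perm _ _ _ _).trans (Eq.trans ?_ (perm_comp _ _ _ _).symm)
  rw [kron_apply]
  refine Eq.trans (congrArg (fun a => a * _) ?_) (one_mul _)
  exact Mat.id_apply_self S unitObj _

theorem rightUnitor_nat {X Y : Mat S} (f : X ⟶ Y) :
    kron f (𝟙 unitObj) ≫ (ρ_ Y).hom = (ρ_ X).hom ≫ f := by
  ext i k
  refine (comp_perm _ _ _ _).trans (Eq.trans ?_ (perm_comp _ _ _ _).symm)
  rw [kron_apply]
  refine Eq.trans (congrArg (fun a => _ * a) ?_) (mul_one _)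
  exact Mat.id_apply_self S unitObj _

theorem pentagon_eq (W X Y Z : Mat S) :
    kron (α_ W X Y).hom (𝟙 Z) ≫ (α_ W (X ⊗ Y) Z).hom ≫ kron (𝟙 W) (α_ X Y Z).hom =
      (α_ (W ⊗ X) Y Z).hom ≫ (α_ W X (Y ⊗ Z)).hom := by
  exact eq_of_eq_perm (comp_eq_perm (kron_eq_perm rfl (id_eq_perm Z)) (comp_eq_perm rfl
    (kron_eq_perm (id_eq_perm W) rfl))) (comp_eq_perm rfl rfl) rfl

theorem triangle_eq (X Y : Mat S) :
    (α_ X (𝟙_ (Mat S)) Y).hom ≫ kron (𝟙 X) (λ_ Y).hom = kron (ρ_ X).hom (𝟙 Y) := by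
  exact eq_of_eq_perm (comp_eq_perm rfl (kron_eq_perm (id_eq_perm X) rfl))
    (kron_eq_perm rfl (id_eq_perm Y)) rfl

instance monoidalCategory : MonoidalCategory (Mat S) :=
  MonoidalCategory.ofTensorHom (C := Mat S)
    (id_tensorHom_id := kron_id)
    (id_tensorHom := fun _ _ _ _ => rfl)
    (tensorHom_id := fun _ _ => rfl)
    (tensorHom_comp_tensorHom := kron_comp)
    (associator_naturality := associator_nat)
    (leftUnitor_naturality := leftUnitor_nat)
    (rightUnitor_naturality := rightUnitor_nat)
    (pentagon := pentagon_eq)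
    (triangle := triangle_eq)

/-- The braiding `|x⟩ ⊗ |y⟩ ↦ |y⟩ ⊗ |x⟩`. -/
def swapIso (X Y : Mat S) : X ⊗ Y ≅ Y ⊗ X :=
  permIso (X := tensorObj X Y) (Y := tensorObj Y X) (Equiv.prodComm X Y)

theorem swap_nat {X Y Z W : Mat S} (f : X ⟶ Y) (g : Z ⟶ W) :
    kron f g ≫ (swapIso Y W).hom = (swapIso X Z).hom ≫ kron g f := by
  ext i k
  refine (comp_perm _ _ _ _).trans (Eq.trans ?_ (perm_comp _ _ _ _).symm)
  exact mul_comm _ _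

instance symmetricCategory : SymmetricCategory (Mat S) where
  braiding := swapIso
  braiding_naturality_right X _ _ f := swap_nat (𝟙 X) f
  braiding_naturality_left f Z := swap_nat f (𝟙 Z)
  hexagon_forward _ Y Z :=
    eq_of_eq_perm (comp_eq_perm rfl (comp_eq_perm rfl rfl))
      (comp_eq_perm (kron_eq_perm rfl (id_eq_perm Z))
        (comp_eq_perm rfl (kron_eq_perm (id_eq_perm Y) rfl))) rfl
  hexagon_reverse X Y _ :=
    eq_of_eq_perm (comp_eq_perm rfl (comp_eq_perm rfl rfl))
      (comp_eq_perm (kron_eq_perm (id_eq_perm X) rfl)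
        (comp_eq_perm rfl (kron_eq_perm rfl (id_eq_perm Y)))) rfl
  symmetry X Y := (comp_eq_perm rfl rfl).trans (id_eq_perm (X ⊗ Y)).symm

open scoped Classical in
/-- The standard cup `∑ x, |x*⟩ ⊗ |x⟩`, where the dual of `S ^ X` is identified with `S ^ X` by
means of the dual basis `|x*⟩`. -/
def cup (X : Mat S) : 𝟙_ (Mat S) ⟶ X ⊗ X :=
  show Matrix PUnit.{u + 1} (X × X) S from fun _ p => if p.1 = p.2 then 1 else 0

open scoped Classical in
/-- The standard cap `∑ x, ⟨x| ⊗ ⟨x*|`. -/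
def cap (X : Mat S) : X ⊗ X ⟶ 𝟙_ (Mat S) :=
  show Matrix (X × X) PUnit.{u + 1} S from fun p _ => if p.1 = p.2 then 1 else 0

theorem yank_sum {X : Type u} [Fintype X] [DecidableEq X] (a b : X) :
    ∑ m : X × (X × X), ((if a = m.1 then 1 else 0) * (if m.2.1 = m.2.2 then 1 else 0)) *
      ((if m.1 = m.2.1 then 1 else 0) * (if m.2.2 = b then 1 else 0)) =
    if a = b then (1 : S) else 0 := by
  simp only [Fintype.sum_prod_type, mul_ite, mul_one, mul_zero,
    Finset.sum_ite_eq, Finset.sum_ite_eq', Finset.mem_univ, if_true]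

theorem yank₁ (X : Mat S) :
    X ◁ cup X ≫ (α_ X X X).inv ≫ cap X ▷ X = (ρ_ X).hom ≫ (λ_ X).inv := by
  classical
  let : Fintype X := Fintype.ofFinite X
  ext i k
  have h (m : X × (X × X)) : ((α_ X X X).inv ≫ cap X ▷ X : X ⊗ (X ⊗ X) ⟶ _) m k =
      (if m.1 = m.2.1 then 1 else 0) * (if m.2.2 = k.2 then 1 else 0) :=
    (perm_comp _ _ _ _).trans (congrArg₂ (fun a b => a * b) (by rfl) (Mat.id_apply S X _ _))
  have h' (m : X × (X × X)) : (X ◁ cup X : X ⊗ 𝟙_ (Mat S) ⟶ _) i m =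
      (if i.1 = m.1 then 1 else 0) * (if m.2.1 = m.2.2 then 1 else 0) :=
    congrArg₂ (fun a b => a * b) (Mat.id_apply S X _ _) (by rfl)
  have e : ((ρ_ X).hom ≫ (λ_ X).inv : X ⊗ 𝟙_ (Mat S) ⟶ 𝟙_ (Mat S) ⊗ X) i k =
      if i.1 = k.2 then 1 else 0 := by
    refine (comp_perm (ρ_ X).hom (Equiv.punitProd X).symm i k).trans ?_
    exact if_congr Iff.rfl rfl rfl
  refine Eq.trans ?_ e.symm
  refine (comp_apply (Y := tensorObj X (tensorObj X X)) _ _ _ _).trans ?_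
  refine (Finset.sum_congr rfl fun m _ => congrArg₂ (fun a b => a * b) (h' m) (h m)).trans ?_
  exact yank_sum i.1 k.2

theorem yank₂ (X : Mat S) :
    cup X ▷ X ≫ (α_ X X X).hom ≫ X ◁ cap X = (λ_ X).hom ≫ (ρ_ X).inv := by
  classical
  let : Fintype X := Fintype.ofFinite X
  ext i k
  have h (m : (X × X) × X) : ((α_ X X X).hom ≫ X ◁ cap X : (X ⊗ X) ⊗ X ⟶ _) m k =
      (if m.1.1 = k.1 then 1 else 0) * (if m.1.2 = m.2 then 1 else 0) :=
    (perm_comp _ _ _ _).trans (congrArg₂ (fun a b => a * b) (Mat.id_apply S X _ _) (by rfl))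
  have h' (m : (X × X) × X) : (cup X ▷ X : 𝟙_ (Mat S) ⊗ X ⟶ _) i m =
      (if m.1.1 = m.1.2 then 1 else 0) * (if i.2 = m.2 then 1 else 0) :=
    congrArg₂ (fun a b => a * b) (by rfl) (Mat.id_apply S X _ _)
  have e : ((λ_ X).hom ≫ (ρ_ X).inv : 𝟙_ (Mat S) ⊗ X ⟶ X ⊗ 𝟙_ (Mat S)) i k =
      if i.2 = k.1 then 1 else 0 := by
    refine (comp_perm (λ_ X).hom (Equiv.prodPUnit X).symm i k).trans ?_
    exact if_congr Iff.rfl rfl rfl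
  refine Eq.trans ?_ e.symm
  refine (comp_apply (Y := tensorObj (tensorObj X X) X) _ _ _ _).trans ?_
  refine (Finset.sum_congr rfl fun m _ => congrArg₂ (fun a b => a * b) (h' m) (h m)).trans ?_
  simp only [Fintype.sum_prod_type, mul_ite, mul_one, mul_zero,
    Finset.sum_ite_eq, Finset.mem_univ, if_true]
  rw [Finset.sum_comm]
  simp [eq_comm]

/-- Each object of `Mat S` is dual to itself, with the standard cup and cap. -/
instance exactPairing (X : Mat S) : ExactPairing X X where
  coevaluation' := cup X
  evaluation' := cap X
  coevaluation_evaluation' := yank₁ X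
  evaluation_coevaluation' := yank₂ X

instance leftRigidCategory : LeftRigidCategory (Mat S) where
  leftDual X := { leftDual := X }

variable (S) in
/-- The standard structure on `Mat S`: the Kronecker product with the standard cups and caps. -/
def kronecker : CompactClosedStructure S (Mat S) where
  add_tensor f f' g := by
    ext i j
    exact add_mul _ _ _
  smul_tensor s f g := by
    ext i j
    exact mul_assoc _ _ _
  tensor_add f g g' := by
    ext i j
    exact mul_add _ _ _
  tensor_smul s f g := by
    ext i j
    exact mul_left_comm _ _ _

end MatKronecker

end

/-! The identity functor of `Mat S` is already the required equivalence; only its monoidal data has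
to be found. The one input is that the unit J of the given structure is isomorphic to S^1
(`nonempty_unitIso`). For nontrivial S, endomorphisms of a monoidal unit commute, which forbids two
basis vectors in J; and J is not the zero module, since bilinearity would then annihilate every
identity.

Given J ≅ S^1, each S^X has kets J → S^X and bras S^X → J whose composites sum to the identity.
Bilinearity of ⊙ on morphisms makes the tensored kets and bras resolve the identity of S^X ⊙ S^Y
(`IsResolution.tensor`). So, although ⊙ on objects is arbitrary, S^X ⊙ S^Y has a basis indexed by X
× Y, and |x⟩ ⊙ |y⟩ ↦ |(x, y)⟩ is an isomorphism (`tensorator`). Naturality is a comparison of matrix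
entries, and every coherence law can be tested on kets, where the standard structure maps merely
permute basis vectors (`coreMonoidal`, `braided`).

Cups and caps need no further computation: a strong monoidal functor sends dual pairs to dual pairs,
and two left duals of an object are related by an isomorphism matching cups with cups and caps with
caps (`DualComparison.ofMonoidal`). -/

noncomputable section

/-! ### Strong monoidal functors preserve left duals -/

section Duals

variable {C : Type u₁} [Category.{v₁} C] [MonoidalCategory C]
  {D : Type u₂} [Category.{v₂} D] [MonoidalCategory D]

/-- A morphism out of a left dual is determined by its composite with the coevaluation. -/
theorem eq_of_coevaluation_comp_whiskerRight {A Y Z : D} [ExactPairing A Y] {g g' : A ⟶ Z}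
    (h : η_ A Y ≫ g ▷ Y = η_ A Y ≫ g' ▷ Y) : g = g' := by
  have h' := congrArg (tensorRightHomEquiv (𝟙_ D) A Y Z).symm h
  simpa using h'

/-- The comparison of two left duals of Y is the mate of the identity of Y, so this is the defining
property of mates at that identity. -/
theorem coevaluation_comp_leftDualIso {A B Y : D} (p : ExactPairing A Y) (q : ExactPairing B Y) :
    p.coevaluation ≫ (leftDualIso p q).hom ▷ Y = q.coevaluation := by
  have h := @coevaluation_comp_leftAdjointMate D _ _ Y Y ⟨B⟩ ⟨A⟩ (𝟙 Y)
  rw [MonoidalCategory.whiskerLeft_id, Category.comp_id] at h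
  exact h

theorem leftDualIso_comp_evaluation {A B Y : D} (p : ExactPairing A Y) (q : ExactPairing B Y) :
    Y ◁ (leftDualIso p q).hom ≫ q.evaluation = p.evaluation := by
  have h := @leftAdjointMate_comp_evaluation D _ _ Y Y ⟨B⟩ ⟨A⟩ (𝟙 Y)
  rw [MonoidalCategory.id_whiskerRight, Category.id_comp] at h
  exact h

open Functor.LaxMonoidal Functor.OplaxMonoidal

/-- The image of an exact pairing under a strong monoidal functor. -/
@[reducible]
def CategoryTheory.ExactPairing.map (F : C ⥤ D) [F.Monoidal] (X Y : C) [ExactPairing X Y] :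
    ExactPairing (F.obj X) (F.obj Y) where
  coevaluation' := ε F ≫ F.map (η_ X Y) ≫ δ F X Y
  evaluation' := μ F Y X ≫ F.map (ε_ X Y) ≫ η F
  coevaluation_evaluation' := by
    have h := congrArg F.map (ExactPairing.coevaluation_evaluation X Y)
    -- Composing with the tensorators at both ends lets each structure map of F inside the image of
    -- the snake equation meet its inverse; only unit comparisons remain.
    rw [← cancel_epi (μ F Y (𝟙_ C)), ← cancel_mono (δ F (𝟙_ C) Y)] at h
    simp only [Functor.map_comp, Functor.Monoidal.map_whiskerLeft,
      Functor.Monoidal.map_whiskerRight, Functor.Monoidal.map_associator_inv,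
      Functor.Monoidal.map_rightUnitor, Functor.Monoidal.map_leftUnitor_inv, Category.assoc,
      Functor.Monoidal.μ_δ, Functor.Monoidal.μ_δ_assoc, Category.comp_id] at h
    simp only [MonoidalCategory.whiskerLeft_comp, comp_whiskerRight, Category.assoc]
    rw [reassoc_of% h, ← comp_whiskerRight, Functor.Monoidal.ε_η, id_whiskerRight,
      Category.comp_id, ← MonoidalCategory.whiskerLeft_comp_assoc, Functor.Monoidal.ε_η,
      MonoidalCategory.whiskerLeft_id, Category.id_comp]
  evaluation_coevaluation' := by
    have h := congrArg F.map (ExactPairing.evaluation_coevaluation X Y)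
    rw [← cancel_epi (μ F (𝟙_ C) X), ← cancel_mono (δ F X (𝟙_ C))] at h
    simp only [Functor.map_comp, Functor.Monoidal.map_whiskerLeft,
      Functor.Monoidal.map_whiskerRight, Functor.Monoidal.map_associator,
      Functor.Monoidal.map_leftUnitor, Functor.Monoidal.map_rightUnitor_inv, Category.assoc,
      Functor.Monoidal.μ_δ, Functor.Monoidal.μ_δ_assoc, Category.comp_id] at h
    simp only [MonoidalCategory.whiskerLeft_comp, comp_whiskerRight, Category.assoc]
    rw [reassoc_of% h, ← MonoidalCategory.whiskerLeft_comp, Functor.Monoidal.ε_η,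
      MonoidalCategory.whiskerLeft_id, Category.comp_id, ← comp_whiskerRight_assoc,
      Functor.Monoidal.ε_η, id_whiskerRight, Category.id_comp]

/-- A strong monoidal functor carries the mate of a morphism to the mate of its image. -/
theorem map_leftAdjointMate (F : C ⥤ D) [F.Monoidal] {X Y : C} [HasLeftDual X] [HasLeftDual Y]
    (f : X ⟶ Y) :
    F.map (ᘁf) = @leftAdjointMate D _ _ _ _
      { leftDual := F.obj (ᘁX), exact := ExactPairing.map F _ X }
      { leftDual := F.obj (ᘁY), exact := ExactPairing.map F _ Y } (F.map f) := by
  let p : ExactPairing (F.obj (ᘁY)) (F.obj Y) := ExactPairing.map F _ Y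
  let q : ExactPairing (F.obj (ᘁX)) (F.obj X) := ExactPairing.map F _ X
  apply eq_of_coevaluation_comp_whiskerRight (Y := F.obj Y)
  refine Eq.trans ?_ (@coevaluation_comp_leftAdjointMate D _ _ _ _
    { leftDual := _, exact := q } { leftDual := _, exact := p } (F.map f)).symm
  change (ε F ≫ F.map (η_ (ᘁY) Y) ≫ δ F (ᘁY) Y) ≫ F.map (ᘁf) ▷ F.obj Y =
    (ε F ≫ F.map (η_ (ᘁX) X) ≫ δ F (ᘁX) X) ≫ F.obj (ᘁX) ◁ F.map f
  have h := congrArg F.map (coevaluation_comp_leftAdjointMate f)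
  simp only [Functor.map_comp] at h
  simp only [Category.assoc, δ_natural_left, δ_natural_right]
  rw [reassoc_of% h]

/-- The comparison of duals is given by uniqueness of left duals. -/
def DualComparison.ofMonoidal [LeftRigidCategory C] [LeftRigidCategory D] (F : C ⥤ D)
    [F.Monoidal] : DualComparison F where
  iso X := leftDualIso (ExactPairing.map F _ X) HasLeftDual.exact
  naturality {X Y} f := by
    let p := ExactPairing.map F (ᘁX) X
    let q := ExactPairing.map F (ᘁY) Y
    rw [map_leftAdjointMate]
    -- Both composites are mates, of 𝟙 ≫ F f and of F f ≫ 𝟙, taken from the image dual of F Y to the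
    -- chosen dual of F X.
    refine (@comp_leftAdjointMate D _ _ _ _ _ ⟨_⟩ ⟨F.obj (ᘁX)⟩ ⟨F.obj (ᘁY)⟩ _ _).symm.trans
      (Eq.trans ?_ (@comp_leftAdjointMate D _ _ _ _ _ ⟨_⟩ ⟨_⟩ ⟨F.obj (ᘁY)⟩ _ _))
    rw [Category.id_comp, Category.comp_id]
  map_cup X := by
    have h := coevaluation_comp_leftDualIso (ExactPairing.map F (ᘁX) X)
      (HasLeftDual.exact (Y := F.obj X))
    rw [← cancel_epi (ε F), Functor.Monoidal.ε_η_assoc]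
    refine Eq.trans ?_ h
    exact ((Category.assoc _ _ _).trans (congrArg _ (Category.assoc _ _ _))).symm
  map_cap X := by
    have h := leftDualIso_comp_evaluation (ExactPairing.map F (ᘁX) X)
      (HasLeftDual.exact (Y := F.obj X))
    rw [← cancel_mono (η F)]
    simp only [Category.assoc, Functor.Monoidal.ε_η, Category.comp_id]
    exact h.symm

end Duals

/-! ### Linear functors out of the category of matrices -/

namespace CompactClosedStructure

variable {S : Type w} [CommSemiring S] {C : Type u} [Category.{v} C] [SemiringLinear S C]
  (T : CompactClosedStructure S C)

instance homAddCommMonoid (X Y : T.Cat) : AddCommMonoid (X ⟶ Y) :=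
  SemiringLinear.homAddCommMonoid S X Y

instance homModule (X Y : T.Cat) : Module S (X ⟶ Y) :=
  SemiringLinear.homModule X Y

variable {T} {W X Y Z : T.Cat}

theorem smul_comp (s : S) (f : X ⟶ Y) (g : Y ⟶ Z) : (s • f) ≫ g = s • (f ≫ g) :=
  SemiringLinear.smul_comp s f g

theorem comp_smul (s : S) (f : X ⟶ Y) (g : Y ⟶ Z) : f ≫ (s • g) = s • (f ≫ g) :=
  SemiringLinear.comp_smul s f g

theorem smul_tensorHom (s : S) (f : X ⟶ Y) (g : Z ⟶ W) : (s • f) ⊗ₘ g = s • (f ⊗ₘ g) :=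
  T.smul_tensor s f g

theorem tensorHom_smul (s : S) (f : X ⟶ Y) (g : Z ⟶ W) : f ⊗ₘ (s • g) = s • (f ⊗ₘ g) :=
  T.tensor_smul s f g

/-- Composition, as a bilinear map. -/
def compₗ (X Y Z : T.Cat) : (X ⟶ Y) →ₗ[S] (Y ⟶ Z) →ₗ[S] (X ⟶ Z) :=
  LinearMap.mk₂ S (fun f g => f ≫ g) (SemiringLinear.add_comp (S := S)) smul_comp
    (SemiringLinear.comp_add (S := S)) comp_smul

/-- The tensor product of morphisms, as a bilinear map. -/
def tensorHomₗ (X Y Z W : T.Cat) : (X ⟶ Y) →ₗ[S] (Z ⟶ W) →ₗ[S] (X ⊗ Z ⟶ Y ⊗ W) :=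
  LinearMap.mk₂ S (fun f g => f ⊗ₘ g) T.add_tensor smul_tensorHom T.tensor_add tensorHom_smul

theorem sum_comp {ι : Type*} (s : Finset ι) (f : ι → (X ⟶ Y)) (g : Y ⟶ Z) :
    (∑ i ∈ s, f i) ≫ g = ∑ i ∈ s, f i ≫ g :=
  LinearMap.map_sum₂ (compₗ X Y Z) s f g

theorem comp_sum {ι : Type*} (s : Finset ι) (f : X ⟶ Y) (g : ι → (Y ⟶ Z)) :
    f ≫ (∑ i ∈ s, g i) = ∑ i ∈ s, f ≫ g i :=
  map_sum (compₗ X Y Z f) g s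

theorem sum_tensorHom {ι : Type*} (s : Finset ι) (f : ι → (X ⟶ Y)) (g : Z ⟶ W) :
    (∑ i ∈ s, f i) ⊗ₘ g = ∑ i ∈ s, f i ⊗ₘ g :=
  LinearMap.map_sum₂ (tensorHomₗ X Y Z W) s f g

theorem tensorHom_sum {ι : Type*} (s : Finset ι) (f : X ⟶ Y) (g : ι → (Z ⟶ W)) :
    f ⊗ₘ (∑ i ∈ s, g i) = ∑ i ∈ s, f ⊗ₘ g i :=
  map_sum (tensorHomₗ X Y Z W f) g s

theorem zero_comp (g : Y ⟶ Z) : (0 : X ⟶ Y) ≫ g = 0 :=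
  LinearMap.map_zero₂ (compₗ X Y Z) g

theorem comp_zero (f : X ⟶ Y) : f ≫ (0 : Y ⟶ Z) = 0 :=
  map_zero (compₗ X Y Z f)

theorem zero_tensorHom (g : Z ⟶ W) : (0 : X ⟶ Y) ⊗ₘ g = 0 :=
  LinearMap.map_zero₂ (tensorHomₗ X Y Z W) g

theorem tensorHom_zero (f : X ⟶ Y) : f ⊗ₘ (0 : Z ⟶ W) = 0 :=
  map_zero (tensorHomₗ X Y Z W f)

end CompactClosedStructure

/-! ### Basis vectors and coordinates in the category of matrices. -/

namespace MatKronecker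

variable {S : Type u} [CommSemiring S]

instance homAddCommMonoid (X Y : Mat S) : AddCommMonoid (X ⟶ Y) :=
  SemiringLinear.homAddCommMonoid S X Y

instance homModule (X Y : Mat S) : Module S (X ⟶ Y) :=
  SemiringLinear.homModule X Y

theorem smul_apply {X Y : Mat S} (s : S) (f : X ⟶ Y) (i : X) (j : Y) :
    (s • f) i j = s * f i j := rfl

theorem sum_apply {X Y : Mat S} {ι : Type*} (s : Finset ι) (f : ι → (X ⟶ Y)) (i : X) (j : Y) :
    (∑ k ∈ s, f k) i j = ∑ k ∈ s, f k i j :=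
  Matrix.sum_apply i j s f

open scoped Classical in
/-- The basis vector `|x⟩`, as a morphism from the unit. -/
def ket {X : Mat S} (x : X) : (unitObj : Mat S) ⟶ X := fun _ i => if x = i then 1 else 0

open scoped Classical in
/-- The coordinate `⟨x|`, as a morphism to the unit. -/
def bra {X : Mat S} (x : X) : X ⟶ (unitObj : Mat S) := fun i _ => if i = x then 1 else 0

theorem comp_bra {X Y : Mat S} (f : X ⟶ Y) (y : Y) (i : X) (k : (unitObj : Mat S)) :
    (f ≫ bra y) i k = f i y := by
  classical
  let : Fintype Y := Fintype.ofFinite Y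
  rw [comp_apply]
  simp [bra]

theorem ket_comp {X Y : Mat S} (x : X) (f : X ⟶ Y) (i : (unitObj : Mat S)) (k : Y) :
    (ket x ≫ f) i k = f x k := by
  classical
  let : Fintype X := Fintype.ofFinite X
  rw [comp_apply]
  simp [ket]

/-- The matrix entries of a morphism, as endomorphisms of the unit. -/
theorem ket_comp_comp_bra {X Y : Mat S} (f : X ⟶ Y) (x : X) (y : Y) :
    ket x ≫ f ≫ bra y = f x y • 𝟙 unitObj := by
  ext i j
  rw [ket_comp, comp_bra, smul_apply, Mat.id_apply, if_pos (Subsingleton.elim (α := PUnit) i j),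
    mul_one]

theorem sum_bra_comp_ket (X : Mat S) [Fintype X] : ∑ x : X, bra x ≫ ket x = 𝟙 X := by
  classical
  let : Fintype (unitObj : Mat S) := inferInstanceAs (Fintype PUnit)
  ext i j
  rw [sum_apply, Mat.id_apply]
  have (x : X) : (bra x ≫ ket x) i j = if x = j then if i = x then 1 else 0 else 0 := by
    rw [comp_apply, Fintype.sum_subsingleton _ PUnit.unit]
    simp [bra, ket]
  simp [this]

end MatKronecker

/-! ### Resolutions of the identity and their tensor products. -/

namespace CompactClosedStructure

variable {S : Type w} [CommSemiring S] {C : Type u} [Category.{v} C] [SemiringLinear S C]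
  {T : CompactClosedStructure S C} {ι κ : Type*} [Fintype ι] [Fintype κ] {A B X Y Z : T.Cat}

/-- The families `e i : A ⟶ X` and `p i : X ⟶ A` form a resolution of the identity of `X`. -/
def IsResolution (e : ι → (A ⟶ X)) (p : ι → (X ⟶ A)) : Prop :=
  ∑ i, p i ≫ e i = 𝟙 X

namespace IsResolution

/-- This one-term resolution leaves the unit factor untouched when the unit laws are tested on kets.
-/
theorem refl (X : T.Cat) : IsResolution (fun _ : Unit => 𝟙 X) fun _ => 𝟙 X := by
  simp [IsResolution]

variable {e : ι → (A ⟶ X)} {p : ι → (X ⟶ A)} {e' : κ → (B ⟶ Y)} {p' : κ → (Y ⟶ B)}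

theorem hom_ext (h : IsResolution e p) {f g : X ⟶ Z} (w : ∀ i, e i ≫ f = e i ≫ g) : f = g := by
  rw [← Category.id_comp f, ← Category.id_comp g, ← h, sum_comp, sum_comp]
  simp only [Category.assoc, w]

theorem hom_ext' (h : IsResolution e p) {f g : Z ⟶ X} (w : ∀ i, f ≫ p i = g ≫ p i) : f = g := by
  rw [← Category.comp_id f, ← Category.comp_id g, ← h, comp_sum, comp_sum]
  simp only [reassoc_of% w]

/-- By bilinearity the double sum factors as the tensor product of the two single sums. This gives
control of morphisms out of X ⊗ Y without any knowledge of the object itself. -/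
theorem tensor (h : IsResolution e p) (h' : IsResolution e' p') :
    IsResolution (fun k : ι × κ => e k.1 ⊗ₘ e' k.2) fun k => p k.1 ⊗ₘ p' k.2 := by
  simp only [IsResolution, tensorHom_comp_tensorHom, Fintype.sum_prod_type, ← tensorHom_sum,
    ← sum_tensorHom]
  rw [h, h', id_tensorHom_id]

end IsResolution

end CompactClosedStructure

/-! ### Images of bases under a linear functor, and the tensorator. -/

namespace MatKronecker

open CompactClosedStructure

variable {S : Type u} [CommSemiring S] {C : Type u₁} [Category.{v₁} C] [SemiringLinear S C]
  {T : CompactClosedStructure S C} {G : Mat S ⥤ T.Cat}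

theorem map_smul (hG : IsSLinearFunctor S G) {X Y : Mat S} (s : S) (f : X ⟶ Y) :
    G.map (s • f) = s • G.map f :=
  hG.map_smul s f

theorem map_sum (hG : IsSLinearFunctor S G) {X Y : Mat S} {ι : Type*} (s : Finset ι)
    (f : ι → (X ⟶ Y)) : G.map (∑ i ∈ s, f i) = ∑ i ∈ s, G.map (f i) :=
  _root_.map_sum ({ toFun := G.map, map_add' := hG.map_add, map_smul' := hG.map_smul } :
    (X ⟶ Y) →ₗ[S] (G.obj X ⟶ G.obj Y)) f s

variable (i : G.obj unitObj ≅ 𝟙_ T.Cat) {X Y Z : Mat S}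

/-- The image of a basis vector. -/
def mapKet (x : X) : 𝟙_ T.Cat ⟶ G.obj X := i.inv ≫ G.map (ket x)

/-- The image of a coordinate. -/
def mapBra (x : X) : G.obj X ⟶ 𝟙_ T.Cat := G.map (bra x) ≫ i.hom

theorem mapKet_comp_map_comp_mapBra (hG : IsSLinearFunctor S G) (f : X ⟶ Y) (x : X) (y : Y) :
    mapKet i x ≫ G.map f ≫ mapBra i y = f x y • 𝟙 (𝟙_ T.Cat) := by
  have h : G.map (ket x) ≫ G.map f ≫ G.map (bra y) = f x y • 𝟙 (G.obj unitObj) := by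
    rw [← G.map_comp, ← G.map_comp, ket_comp_comp_bra, map_smul hG, G.map_id]
  simp only [mapKet, mapBra, Category.assoc]
  rw [reassoc_of% h, smul_comp, comp_smul, Category.id_comp, i.inv_hom_id]

open scoped Classical in
theorem mapKet_comp_mapBra (hG : IsSLinearFunctor S G) (x y : X) :
    mapKet i x ≫ mapBra i y = if x = y then 𝟙 (𝟙_ T.Cat) else 0 := by
  have h := mapKet_comp_map_comp_mapBra i hG (𝟙 X) x y
  rw [G.map_id, Category.id_comp, Mat.id_apply] at h
  rw [h]
  split_ifs
  · rw [one_smul]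
  · rw [zero_smul]

/-- The standard associator, unitors and braiding are all permutation matrices, so this evaluates
each of them on a ket. -/
theorem mapKet_comp_perm (e : X ≃ Y) (x : X) :
    mapKet i x ≫ G.map (perm e) = mapKet i (e x) := by
  rw [mapKet, mapKet, Category.assoc, ← G.map_comp]
  congr 2
  ext
  rw [ket_comp]
  simp [perm, ket]

theorem isResolution (hG : IsSLinearFunctor S G) (X : Mat S) [Fintype X] :
    IsResolution (mapKet i (X := X)) (mapBra i) := by
  simp only [IsResolution, mapKet, mapBra, Category.assoc, i.hom_inv_id_assoc, ← G.map_comp]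
  rw [← map_sum hG, sum_bra_comp_ket, G.map_id]

instance fintypeObj (X : Mat S) : Fintype X := Fintype.ofFinite X

/-- The tensorator of a linear functor out of the category of matrices. -/
def tensoratorHom (X Y : Mat S) : G.obj X ⊗ G.obj Y ⟶ G.obj (X ⊗ Y) :=
  ∑ z : X × Y, (mapBra i z.1 ⊗ₘ mapBra i z.2) ≫ (λ_ (𝟙_ T.Cat)).hom ≫
    mapKet i (X := X ⊗ Y) z

/-- The inverse of the tensorator. -/
def tensoratorInv (X Y : Mat S) : G.obj (X ⊗ Y) ⟶ G.obj X ⊗ G.obj Y :=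
  ∑ z : X × Y, mapBra i (X := X ⊗ Y) z ≫ (λ_ (𝟙_ T.Cat)).inv ≫
    (mapKet i z.1 ⊗ₘ mapKet i z.2)

/-- Orthogonality of kets and bras leaves a single term of the sum. This formula is all that the
coherence proofs need to know about the tensorator. -/
theorem mapKet_tensor_comp_tensoratorHom (hG : IsSLinearFunctor S G) (x : X) (y : Y) :
    (mapKet i x ⊗ₘ mapKet i y) ≫ tensoratorHom i X Y =
      (λ_ (𝟙_ T.Cat)).hom ≫ mapKet i (X := X ⊗ Y) (x, y) := by
  rw [tensoratorHom, comp_sum, Fintype.sum_eq_single (x, y)]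
  · simp [tensorHom_comp_tensorHom_assoc, mapKet_comp_mapBra i hG]
  · rintro ⟨x', y'⟩ h
    rw [tensorHom_comp_tensorHom_assoc, mapKet_comp_mapBra i hG, mapKet_comp_mapBra i hG]
    rw [Ne, Prod.mk.injEq, not_and_or] at h
    rcases h with h | h
    · rw [if_neg (Ne.symm h), zero_tensorHom, zero_comp]
    · rw [if_neg (Ne.symm h), tensorHom_zero, zero_comp]

theorem mapKet_comp_tensoratorInv (hG : IsSLinearFunctor S G) (x : X) (y : Y) :
    mapKet i (X := X ⊗ Y) (x, y) ≫ tensoratorInv i X Y =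
      (λ_ (𝟙_ T.Cat)).inv ≫ (mapKet i x ⊗ₘ mapKet i y) := by
  rw [tensoratorInv, comp_sum, Fintype.sum_eq_single (x, y)]
  · rw [← Category.assoc, mapKet_comp_mapBra i hG, if_pos rfl, Category.id_comp]
  · intro z h
    rw [← Category.assoc, mapKet_comp_mapBra i hG, if_neg (Ne.symm h), zero_comp]

theorem tensoratorHom_comp_mapBra (hG : IsSLinearFunctor S G) (x : X) (y : Y) :
    tensoratorHom i X Y ≫ mapBra i (X := X ⊗ Y) (x, y) =
      (mapBra i x ⊗ₘ mapBra i y) ≫ (λ_ (𝟙_ T.Cat)).hom := by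
  rw [tensoratorHom, sum_comp, Fintype.sum_eq_single (x, y)]
  · simp only [Category.assoc]
    rw [mapKet_comp_mapBra i hG, if_pos rfl, Category.comp_id]
  · intro z h
    simp only [Category.assoc]
    rw [mapKet_comp_mapBra i hG, if_neg h, comp_zero, comp_zero]

/-- The tensorator as an isomorphism. -/
def tensorator (hG : IsSLinearFunctor S G) (X Y : Mat S) :
    G.obj X ⊗ G.obj Y ≅ G.obj (X ⊗ Y) where
  hom := tensoratorHom i X Y
  inv := tensoratorInv i X Y
  hom_inv_id := by
    refine ((isResolution i hG X).tensor (isResolution i hG Y)).hom_ext fun z => ?_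
    rw [reassoc_of% mapKet_tensor_comp_tensoratorHom i hG, mapKet_comp_tensoratorInv i hG,
      Iso.hom_inv_id_assoc, Category.comp_id]
  inv_hom_id := by
    refine (isResolution i hG (X ⊗ Y)).hom_ext fun z => ?_
    refine ((reassoc_of% mapKet_comp_tensoratorInv i hG z.1 z.2) _).trans ?_
    rw [mapKet_tensor_comp_tensoratorHom i hG, Iso.inv_hom_id_assoc, Category.comp_id]
    rfl

/-- Between a pair of kets and a bra both sides give the same scalar: bilinearity extracts the
product of an entry of f and an entry of g, which is by definition an entry of their Kronecker
product. -/
theorem tensoratorHom_natural (hG : IsSLinearFunctor S G) {X' Y' : Mat S} (f : X ⟶ X')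
    (g : Y ⟶ Y') : (G.map f ⊗ₘ G.map g) ≫ tensoratorHom i X' Y' =
      tensoratorHom i X Y ≫ G.map (f ⊗ₘ g) := by
  refine ((isResolution i hG X).tensor (isResolution i hG Y)).hom_ext fun z => ?_
  refine (isResolution i hG (X' ⊗ Y')).hom_ext' fun z' => ?_
  obtain ⟨x', y'⟩ : X' × Y' := z'
  simp only [Category.assoc]
  rw [tensoratorHom_comp_mapBra i hG, reassoc_of% mapKet_tensor_comp_tensoratorHom i hG,
    mapKet_comp_map_comp_mapBra i hG, tensorHom_comp_tensorHom_assoc,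
    tensorHom_comp_tensorHom_assoc, Category.assoc, Category.assoc,
    mapKet_comp_map_comp_mapBra i hG, mapKet_comp_map_comp_mapBra i hG, smul_tensorHom,
    tensorHom_smul, smul_smul, smul_comp, comp_smul, id_tensorHom_id, Category.id_comp,
    Category.comp_id]
  rfl

/-- The only ket of S^1 is its identity matrix. Hence the unit comparison is itself a ket, and the
tensorator formula applies to it in the unit laws. -/
theorem mapKet_unit (k : (unitObj : Mat S)) : mapKet i k = i.inv := by
  have : ket k = 𝟙 (unitObj : Mat S) := by
    ext a b
    obtain rfl : k = a := Subsingleton.elim (α := PUnit) _ _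
    rw [← Category.comp_id (ket k), ket_comp]
  rw [mapKet, this, G.map_id, Category.comp_id]

/-! ### Coherence of the tensorator. -/

/-- A linear functor out of the category of matrices which preserves the unit is strong
monoidal. -/
def coreMonoidal (hG : IsSLinearFunctor S G) : G.CoreMonoidal where
  εIso := i.symm
  μIso := tensorator i hG
  μIso_hom_natural_left f X' := by
    have h := tensoratorHom_natural i hG f (𝟙 X')
    rw [G.map_id, tensorHom_id, tensorHom_id] at h
    exact h
  μIso_hom_natural_right X' f := by
    have h := tensoratorHom_natural i hG (𝟙 X') f
    rw [G.map_id, id_tensorHom, id_tensorHom] at h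
    exact h
  associativity X Y Z := by
    -- On kets both routes end in |(x, (y, z))⟩. They differ only in how the copies of the unit are
    -- collapsed, which the triangle identity and the equality of the two unitors at the unit
    -- reconcile.
    refine (((isResolution i hG X).tensor (isResolution i hG Y)).tensor
      (isResolution i hG Z)).hom_ext fun z => ?_
    obtain ⟨⟨x, y⟩, z⟩ := z
    change _ ≫ tensoratorHom i X Y ▷ _ ≫ tensoratorHom i (X ⊗ Y) Z ≫ G.map (perm _) =
      _ ≫ _ ≫ _ ◁ tensoratorHom i Y Z ≫ tensoratorHom i X (Y ⊗ Z)
    rw [← tensorHom_id, tensorHom_comp_tensorHom_assoc, Category.comp_id,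
      mapKet_tensor_comp_tensoratorHom i hG, associator_naturality_assoc, ← id_tensorHom,
      tensorHom_comp_tensorHom_assoc, Category.comp_id, mapKet_tensor_comp_tensoratorHom i hG,
      ← Category.id_comp (mapKet i z), ← tensorHom_comp_tensorHom_assoc,
      reassoc_of% mapKet_tensor_comp_tensoratorHom i hG,
      ← Category.id_comp (mapKet i x), ← tensorHom_comp_tensorHom_assoc,
      mapKet_tensor_comp_tensoratorHom i hG, id_tensorHom, triangle_assoc, tensorHom_id,
      unitors_equal]
    congr 2
    exact mapKet_comp_perm i (X := (X ⊗ Y) ⊗ Z) (Y := X ⊗ (Y ⊗ Z)) (Equiv.prodAssoc X Y Z) _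
  left_unitality X := by
    refine ((IsResolution.refl _).tensor (isResolution i hG X)).hom_ext fun z => ?_
    change _ = _ ≫ i.inv ▷ _ ≫ tensoratorHom i unitObj X ≫ G.map (perm _)
    rw [← tensorHom_id, tensorHom_comp_tensorHom_assoc, Category.comp_id, Category.id_comp,
      ← mapKet_unit i PUnit.unit, reassoc_of% mapKet_tensor_comp_tensoratorHom i hG, id_tensorHom,
      leftUnitor_naturality]
    congr 1
    exact (mapKet_comp_perm i (X := unitObj ⊗ X) (Y := X) (Equiv.punitProd X)
      (PUnit.unit, z.2)).symm
  right_unitality X := by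
    refine ((isResolution i hG X).tensor (IsResolution.refl _)).hom_ext fun z => ?_
    change _ = _ ≫ _ ◁ i.inv ≫ tensoratorHom i X unitObj ≫ G.map (perm _)
    rw [← id_tensorHom, tensorHom_comp_tensorHom_assoc, Category.comp_id, Category.id_comp,
      ← mapKet_unit i PUnit.unit, reassoc_of% mapKet_tensor_comp_tensoratorHom i hG, tensorHom_id,
      rightUnitor_naturality, unitors_equal]
    congr 1
    exact (mapKet_comp_perm i (X := X ⊗ unitObj) (Y := X) (Equiv.prodPUnit X)
      (z.1, PUnit.unit)).symm

/-- A linear functor out of the category of matrices which preserves the unit is strong symmetric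
monoidal. -/
@[reducible]
def braided (hG : IsSLinearFunctor S G) : G.Braided where
  toMonoidal := (coreMonoidal i hG).toMonoidal
  braided X Y := by
    -- Naturality moves the braiding past the kets onto two copies of the unit, where the unitors
    -- absorb it.
    refine ((isResolution i hG X).tensor (isResolution i hG Y)).hom_ext fun z => ?_
    change _ ≫ tensoratorHom i X Y ≫ G.map (perm _) = _ ≫ _ ≫ tensoratorHom i Y X
    rw [reassoc_of% mapKet_tensor_comp_tensoratorHom i hG,
      BraidedCategory.braiding_naturality_assoc, mapKet_tensor_comp_tensoratorHom i hG, ← Category.assoc (β_ _ _).hom, braiding_leftUnitor,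
      ← unitors_equal]
    congr 1
    exact mapKet_comp_perm i (X := X ⊗ Y) (Y := Y ⊗ X) (Equiv.prodComm X Y) _

end MatKronecker

/-! ### The unit of a bilinear monoidal structure on the category of matrices -/

/-- Endomorphisms of the unit of a monoidal category commute. -/
theorem unit_end_comm {C : Type u} [Category.{v} C] [MonoidalCategory C] (f g : 𝟙_ C ⟶ 𝟙_ C) :
    f ≫ g = g ≫ f := by
  -- Eckmann–Hilton: f and g are placed in different factors of the unit tensored with itself, and
  -- the interchange law swaps them.
  rw [← cancel_epi (λ_ (𝟙_ C)).hom]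
  calc (λ_ (𝟙_ C)).hom ≫ f ≫ g = 𝟙_ C ◁ f ≫ g ▷ 𝟙_ C ≫ (ρ_ (𝟙_ C)).hom := by
        rw [← leftUnitor_naturality_assoc, rightUnitor_naturality, unitors_equal]
    _ = (λ_ (𝟙_ C)).hom ≫ g ≫ f := by
        rw [whisker_exchange_assoc, ← unitors_equal, leftUnitor_naturality, unitors_equal,
          rightUnitor_naturality_assoc]

namespace MatKronecker

open CompactClosedStructure

variable {S : Type u} [CommSemiring S]

/-- An object with commuting endomorphisms has at most one basis vector. -/
theorem subsingleton_of_end_comm [Nontrivial S] {X : Mat S} (h : ∀ f g : X ⟶ X, f ≫ g = g ≫ f) :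
    Subsingleton X := by
  classical
  refine ⟨fun x y => by_contra fun hxy => one_ne_zero (α := S) ?_⟩
  -- For x ≠ y the matrix units satisfy E_xx E_xy = E_xy but E_xy E_xx = 0; the (x, y) entries then
  -- give 1 = 0.
  have e := congrArg (fun m : X ⟶ X => m x y) (h (bra x ≫ ket x) (bra x ≫ ket y))
  simp [hxy, bra, ket] at e

/-- The unit of a bilinear monoidal structure on `Mat S` is the free module of rank one. -/
theorem nonempty_unitIso (T : CompactClosedStructure S (Mat S)) :
    Nonempty ((show T.Cat from (unitObj : Mat S)) ≅ 𝟙_ T.Cat) := by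
  -- Over the trivial semiring every hom-set is a singleton, so any two objects are isomorphic and
  -- no count of basis vectors is possible.
  rcases subsingleton_or_nontrivial S with hS | hS
  · have h (X Y : Mat S) (f g : X ⟶ Y) : f = g := by
      ext i j
      exact Subsingleton.elim _ _
    exact ⟨⟨fun _ _ => (0 : S), fun _ _ => (0 : S),
      h _ _ _ _, h _ _ _ _⟩⟩
  let J : Mat S := 𝟙_ T.Cat
  have hJ : Subsingleton J := subsingleton_of_end_comm (unit_end_comm (C := T.Cat))
  rcases isEmpty_or_nonempty J with hE | ⟨⟨j⟩⟩
  · let U : T.Cat := (unitObj : Mat S)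
    -- If J has no basis vectors, its identity is the empty matrix, hence zero. Tensoring with S^1
    -- and applying the left unitor makes the identity of S^1 zero, contradicting 1 ≠ 0.
    have h₀ : 𝟙 (𝟙_ T.Cat) = 0 := by
      refine Mat.hom_ext (𝟙 J) (0 : J ⟶ J) fun i => hE.elim i
    have h₁ : 𝟙 U = 0 := by
      rw [← cancel_epi (λ_ U).hom, ← leftUnitor_naturality, ← id_tensorHom, h₀, zero_tensorHom,
        zero_comp, comp_zero]
    have h₂ := congrArg (fun m : (unitObj : Mat S) ⟶ unitObj => m PUnit.unit PUnit.unit) h₁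
    exact absurd ((Mat.id_apply_self S unitObj _).symm.trans h₂) one_ne_zero
  · let e : (unitObj : Mat S) ≃ J :=
      { toFun := fun _ => j
        invFun := fun _ => PUnit.unit
        left_inv := fun _ => rfl
        right_inv := fun _ => Subsingleton.elim _ _ }
    exact ⟨permIso (S := S) e⟩

end MatKronecker

/-! ### Assembling the equivalence. -/

theorem mainTheorem1 (S : Type u) [CommSemiring S] [StarRing S]
    (T : CompactClosedStructure S (Mat S)) :
    Nonempty (LinearMonoidalEquivalence (MatKronecker.kronecker S) T) := by
  obtain ⟨i⟩ := MatKronecker.nonempty_unitIso T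
  -- Both structures live on the same linear category, so linearity and invertibility of this
  -- functor are immediate; the isomorphism `i` supplies all of its monoidal data.
  let G : Mat S ⥤ T.Cat := 𝟭 (Mat S)
  have hG : IsSLinearFunctor S G := ⟨fun _ _ => rfl, fun _ _ => rfl⟩
  let G' : (MatKronecker.kronecker S).Cat ⥤ T.Cat := G
  let B : G'.Braided := MatKronecker.braided i hG
  exact ⟨{
    equiv := (CategoryTheory.Equivalence.refl : Mat S ≌ Mat S)
    linear := hG
    braided := B
    duals := DualComparison.ofMonoidal G' }⟩

end
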